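/- **Conventions.** Every quantum system is a tensor product of finitely many qudits of odd prime dimension (the empty product is the trivial one-dimensional system). For a qudit of dimension $d$ with basis $|j\rangle$, $j\in\mathbb Z_d$, put $X|j\rangle=|j+1\rangle$, $Z|j\rangle=e^{2\pi i j/d}|j\rangle$, $\tau=e^{(d+1)\pi i/d}$ and $T_{(a_1,a_2)}=\tau^{-a_1a_2}Z^{a_1}X^{a_2}$ for $(a_1,a_2)\in\mathbb Z_d\times\mathbb Z_d$; for composite systems $T_{u\oplus v}=T_u\otimes T_v$. For a system of dimension $d$, the phase-space point operators are $A^0=\frac1d\sum_u T_u$ and $A^u=T_uA^0T_u^\dagger$, and the discrete Wigner function of an operator $V$ is $W_V(u)=\frac1d\operatorname{Tr}[A^uV]$. Let $\mathcal W_+$ be the set of states with non-negative Wigner function. A Hermiticity-preserving linear map $\mathcal N_{A\to B}$ is *CPWP* if for every system $R$ the map $\mathrm{id}_R\otimes\mathcal N$ sends $\mathcal W_+$ on $RA$ into $\mathcal W_+$ on $RB$. A *channel* is a completely positive trace-preserving linear map. A *superchannel* $\Xi_{(A\to B)\to(C\to D)}$ is a linear map from linear maps $A\to B$ (on operators) to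 linear maps $C\to D$ such that $(\mathrm{id}_R\otimes\Xi)(\mathcal N_{RA\to RB})$ is a channel $RC\to RD$ for every finite-dimensional $R$ and every channel $\mathcal N_{RA\to RB}$. It is *CPWP* if $(\mathrm{id}_R\otimes\Xi)(\mathcal N_{RA\to RB})$ is CPWP for every reference system $R$ and every CPWP channel $\mathcal N_{RA\to RB}$. Its bipartite map $\mathcal P_{CB\to AD}$ is given by $$\langle k,s|\,\mathcal P(|i\rangle\langle i'|_C\otimes|l\rangle\langle l'|_B)\,|k',s'\rangle=\langle s|\,\Xi\big(Y\mapsto\langle k|Y|k'\rangle\,|l\rangle\langle l'|\big)(|i\rangle\langle i'|)\,|s'\rangle$$ (so $\mathcal P=\mathcal D_{BM\to D}\circ\mathcal E_{C\to AM}$ whenever $\Xi(\mathcal N)=\mathcal D_{BM\to D}\circ\mathcal N_{A\to B}\circ\mathcal E_{C\to AM}$ for all $\mathcal N$). Its Choi operator $J^\Xi_{CBAD}$ is the Choi operator $\sum_{x,y}|x\rangle\langle y|_{CB}\otimes\mathcal P(|x\rangle\langle y|)$ of $\mathcal P$, and its Wigner function is $$W_\Xi(u_A,v_D|u_C,v_B)=\frac1{d_Ad_D}\operatorname{Tr}\big[(A_A^{u_A}\otimes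 A_D^{v_D})\,\mathcal P_{CB\to AD}(A_C^{u_C}\otimes A_B^{v_B})\big].$$ **Theorem.** Let $\Xi_{(A\to B)\to(C\to D)}$ be a quantum superchannel. The following are equivalent: 1. $\Xi$ is a CPWP superchannel; 2. the discrete Wigner function of the Choi operator $J^\Xi_{CBAD}$ is non-negative; 3. $W_\Xi(u_A,v_D|u_C,v_B)\ge 0$ for all $u_A,v_D,u_C,v_B$; 4. $W_\Xi$ is a classical bipartite channel with a non-signalling constraint, that is, $W_\Xi(u_A,v_D|u_C,v_B)\ge0$ and $\sum_{u_A,v_D}W_\Xi(u_A,v_D|u_C,v_B)=1$ for all arguments, and $\sum_{v_D}W_\Xi(u_A,v_D|u_C,v_B)$ does not depend on $v_B$. -/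

import Mathlib

open Matrix
open scoped Kronecker ComplexOrder

noncomputable section

/-! ### Quantum systems and discrete phase space -/

/-- Quantum systems: tensor products of finitely many qudits of odd prime dimension
(the empty product being the trivial one-dimensional system). -/
inductive QSystem : Type
  | trivial : QSystem
  | qudit (d : ℕ) (prime : d.Prime) (odd : Odd d) : QSystem
  | tensor (A B : QSystem) : QSystem

namespace QSystem

/-- Labels of the computational basis. -/
@[reducible] def Basis : QSystem → Type
  | trivial => Unit
  | qudit d _ _ => ZMod d
  | tensor A B => A.Basis × B.Basis

/-- Points of the discrete phase space: `ℤ_d × ℤ_d` for a qudit, products for composite systems. -/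
@[reducible] def Phase : QSystem → Type
  | trivial => Unit
  | qudit d _ _ => ZMod d × ZMod d
  | tensor A B => A.Phase × B.Phase

instance instFintypeBasis : (S : QSystem) → Fintype S.Basis
  | trivial => inferInstanceAs (Fintype Unit)
  | qudit d hd _ =>
    haveI : NeZero d := ⟨hd.ne_zero⟩
    inferInstanceAs (Fintype (ZMod d))
  | tensor A B =>
    haveI := instFintypeBasis A
    haveI := instFintypeBasis B
    inferInstanceAs (Fintype (A.Basis × B.Basis))

instance instDecidableEqBasis : (S : QSystem) → DecidableEq S.Basis
  | trivial => inferInstanceAs (DecidableEq Unit)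
  | qudit d _ _ => inferInstanceAs (DecidableEq (ZMod d))
  | tensor A B =>
    haveI := instDecidableEqBasis A
    haveI := instDecidableEqBasis B
    inferInstanceAs (DecidableEq (A.Basis × B.Basis))

instance instFintypePhase : (S : QSystem) → Fintype S.Phase
  | trivial => inferInstanceAs (Fintype Unit)
  | qudit d hd _ =>
    haveI : NeZero d := ⟨hd.ne_zero⟩
    inferInstanceAs (Fintype (ZMod d × ZMod d))
  | tensor A B =>
    haveI := instFintypePhase A
    haveI := instFintypePhase B
    inferInstanceAs (Fintype (A.Phase × B.Phase))

/-- The Hilbert space dimension. -/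
def dim (S : QSystem) : ℕ := Fintype.card S.Basis

/-- Operators on the Hilbert space of the system, in the computational basis. -/
abbrev Op (S : QSystem) : Type := Matrix S.Basis S.Basis ℂ

/-- The shift operator `X|j⟩ = |j + 1⟩`. -/
def shiftX (d : ℕ) : Matrix (ZMod d) (ZMod d) ℂ :=
  Matrix.of fun j k => if j = k + 1 then 1 else 0

/-- The boost operator `Z|j⟩ = ω^j |j⟩`, `ω = e^{2πi/d}`. -/
def boostZ (d : ℕ) : Matrix (ZMod d) (ZMod d) ℂ :=
  Matrix.diagonal fun j => Complex.exp (2 * Real.pi * Complex.I / d) ^ j.val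

/-- The Heisenberg–Weyl operators `T_u`: for a qudit and `u = (a₁, a₂)`,
`T_u = τ^{-a₁a₂} Z^{a₁} X^{a₂}` with `τ = e^{(d+1)πi/d}`; for a composite system,
`T_{u ⊕ v} = T_u ⊗ T_v`. (For odd `d` one has `τ^d = 1`, so the choice of representatives
of `a₁, a₂ ∈ ℤ_d` is immaterial.) -/
def weyl : (S : QSystem) → S.Phase → S.Op
  | trivial, _ => 1
  | qudit d hd _, u =>
    haveI : NeZero d := ⟨hd.ne_zero⟩
    (Complex.exp ((d + 1) * Real.pi * Complex.I / d) ^ (-((u.1.val * u.2.val : ℕ) : ℤ))) •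
      (boostZ d ^ u.1.val * shiftX d ^ u.2.val)
  | tensor A B, u => weyl A u.1 ⊗ₖ weyl B u.2

/-- `A_0 = (1/d) ∑_u T_u`. -/
def phasePointZero (S : QSystem) : S.Op := (1 / (S.dim : ℂ)) • ∑ u, S.weyl u

/-- The phase-space point operators `A_u = T_u A_0 T_u†`. -/
def phasePoint (S : QSystem) (u : S.Phase) : S.Op :=
  S.weyl u * S.phasePointZero * (S.weyl u)ᴴ

/-- The discrete Wigner function `W_X(u) = (1/d) Tr[A_u X]`. It is kept complex valued; it is real
when `X` is Hermitian, and `0 ≤ z` for `z : ℂ` means that `z` is real and non-negative. -/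
def wigner (S : QSystem) (X : S.Op) (u : S.Phase) : ℂ :=
  (1 / (S.dim : ℂ)) * (S.phasePoint u * X).trace

/-- `W₊`: quantum states with non-negative discrete Wigner function. -/
def wignerStates (S : QSystem) : Set S.Op :=
  {ρ | ρ.PosSemidef ∧ ρ.trace = 1 ∧ ∀ u, 0 ≤ S.wigner ρ u}

end QSystem

/-! ### Linear maps on operators, channels -/

/-- Linear maps from operators on `ℂ^m` to operators on `ℂ^n`. -/
abbrev OpMap (m n : Type) : Type := Matrix m m ℂ →ₗ[ℂ] Matrix n n ℂ

/-- The map `id_R ⊗ N`. -/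
def idTensor (r : Type) {m n : Type} (N : OpMap m n) : OpMap (r × m) (r × n) where
  toFun X := Matrix.of fun p q => N (Matrix.of fun i j => X (p.1, i) (q.1, j)) p.2 q.2
  map_add' X Y := by
    ext p q
    exact congrFun (congrFun (N.map_add (Matrix.of fun i j => X (p.1, i) (q.1, j))
      (Matrix.of fun i j => Y (p.1, i) (q.1, j))) p.2) q.2
  map_smul' c X := by
    ext p q
    exact congrFun (congrFun (N.map_smul c (Matrix.of fun i j => X (p.1, i) (q.1, j))) p.2) q.2

def IsHermiticityPreserving {m n : Type} (N : OpMap m n) : Prop :=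
  ∀ X, X.IsHermitian → (N X).IsHermitian

def IsCompletelyPositive {m n : Type} (N : OpMap m n) : Prop :=
  ∀ (r : Type) [Fintype r] [DecidableEq r] (X : Matrix (r × m) (r × m) ℂ),
    X.PosSemidef → (idTensor r N X).PosSemidef

/-- Quantum channels: completely positive trace-preserving linear maps. -/
def IsChannel {m n : Type} [Fintype m] [Fintype n] (N : OpMap m n) : Prop :=
  IsCompletelyPositive N ∧ ∀ X, (N X).trace = X.trace

/-- The Choi operator `J^N = ∑_{ij} |i⟩⟨j| ⊗ N(|i⟩⟨j|)`. -/
def choi {m n : Type} [Fintype m] [DecidableEq m] (N : OpMap m n) :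
    Matrix (m × n) (m × n) ℂ :=
  ∑ i, ∑ j, Matrix.single i j (1 : ℂ) ⊗ₖ N (Matrix.single i j 1)

/-- Completely positive-Wigner-preserving maps `A → B`. -/
def IsCPWP (A B : QSystem) (N : OpMap A.Basis B.Basis) : Prop :=
  IsHermiticityPreserving N ∧
    ∀ (R : QSystem), ∀ ρ ∈ (R.tensor A).wignerStates,
      (idTensor R.Basis N ρ : (R.tensor B).Op) ∈ (R.tensor B).wignerStates

/-! ### Superchannels -/

/-- Linear maps taking maps `a → b` to maps `c → d`. -/
abbrev SuperMap (a b c d : Type) : Type := OpMap a b →ₗ[ℂ] OpMap c d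

/-- The `(r, r', s, s')` block of a map `N : RA → RB`, that is the map
`X ↦ ⟨s| N(|r⟩⟨r'| ⊗ X) |s'⟩` from operators on `A` to operators on `B`. -/
def refBlock {r a b : Type} [DecidableEq r] (N : OpMap (r × a) (r × b)) (i i' s s' : r) :
    OpMap a b where
  toFun X := Matrix.of fun k l => N (Matrix.single i i' (1 : ℂ) ⊗ₖ X) (s, k) (s', l)
  map_add' X Y := by
    ext k l
    simp [Matrix.kronecker_add]
  map_smul' c X := by
    ext k l
    simp [Matrix.kronecker_smul]

/-- The map `id_R ⊗ Ξ` (`id_R` the identity supermap on `R → R`), applied to `N : RA → RB`: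
writing `N = ∑ (|r⟩⟨r'| ↦ |s⟩⟨s'|) ⊗ N_{rr'ss'}` with the blocks above, every block
`N_{rr'ss'}` is replaced by `Ξ(N_{rr'ss'})`. -/
def idTensorSuper (r : Type) [Fintype r] [DecidableEq r] {a b c d : Type}
    (Ξ : SuperMap a b c d) (N : OpMap (r × a) (r × b)) : OpMap (r × c) (r × d) where
  toFun Z := Matrix.of fun p q => ∑ i, ∑ i',
    Ξ (refBlock N i i' p.1 q.1) (Matrix.of fun k l => Z (i, k) (i', l)) p.2 q.2
  map_add' Z Z' := by
    ext p q
    simp only [Matrix.of_apply, Matrix.add_apply, ← Finset.sum_add_distrib]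
    refine Finset.sum_congr rfl fun i _ => Finset.sum_congr rfl fun i' _ => ?_
    exact congrFun (congrFun ((Ξ (refBlock N i i' p.1 q.1)).map_add
      (Matrix.of fun k l => Z (i, k) (i', l)) (Matrix.of fun k l => Z' (i, k) (i', l))) p.2) q.2
  map_smul' t Z := by
    ext p q
    simp only [Matrix.of_apply, Matrix.smul_apply, Finset.smul_sum, RingHom.id_apply]
    refine Finset.sum_congr rfl fun i _ => Finset.sum_congr rfl fun i' _ => ?_
    exact congrFun (congrFun ((Ξ (refBlock N i i' p.1 q.1)).map_smul t
      (Matrix.of fun k l => Z (i, k) (i', l))) p.2) q.2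

/-- A superchannel: `(id_R ⊗ Ξ)(N)` is a channel `RC → RD` for every channel `N : RA → RB` and
every (finite-dimensional) reference system `R`. -/
def IsSuperchannel {a b c d : Type} [Fintype a] [Fintype b] [Fintype c] [Fintype d]
    (Ξ : SuperMap a b c d) : Prop :=
  ∀ (r : Type) [Fintype r] [DecidableEq r] (N : OpMap (r × a) (r × b)),
    IsChannel N → IsChannel (idTensorSuper r Ξ N)

/-- The map `X ↦ ⟨k| X |k'⟩ • |l⟩⟨l'|`. -/
def unitMap {a b : Type} [DecidableEq b] (k k' : a) (l l' : b) : OpMap a b where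
  toFun X := X k k' • Matrix.single l l' (1 : ℂ)
  map_add' X Y := by simp [add_smul]
  map_smul' c X := by simp [mul_smul]

/-- The bipartite map `P : CB → AD` corresponding to a supermap `Ξ : (A → B) → (C → D)`:
`⟨k, s| P(|i⟩⟨i'| ⊗ |l⟩⟨l'|) |k', s'⟩ = ⟨s| Ξ(X ↦ ⟨k|X|k'⟩ |l⟩⟨l'|)(|i⟩⟨i'|) |s'⟩`.
When `Ξ(N) = 𝒟 ∘ N ∘ ℰ` with `ℰ : C → AM`, `𝒟 : BM → D`, this is `𝒟 ∘ ℰ`;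
see `bipartiteMap_of_realization`. -/
def bipartiteMap {a b c d : Type} [Fintype b] [DecidableEq b] [Fintype c] [DecidableEq c]
    (Ξ : SuperMap a b c d) : OpMap (c × b) (a × d) where
  toFun Z := Matrix.of fun p q => ∑ x : c × b, ∑ y : c × b,
    Z x y * Ξ (unitMap p.1 q.1 x.2 y.2) (Matrix.single x.1 y.1 1) p.2 q.2
  map_add' Z Z' := by
    ext p q
    simp [add_mul, Finset.sum_add_distrib]
  map_smul' t Z := by
    ext p q
    simp [Finset.mul_sum, mul_assoc]

/-- If `Ξ(N) = 𝒟 ∘ (id_M ⊗ N) ∘ ℰ` for all `N`, then the bipartite map of `Ξ` is `𝒟 ∘ ℰ`: it sends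
`W_C ⊗ Y_B` to the operator on `AD` whose `(k, k')` block is `𝒟(⟨k|ℰ(W)|k'⟩ ⊗ Y)`. -/
theorem bipartiteMap_of_realization {a b c d m : Type} [Fintype b] [DecidableEq b]
    [Fintype c] [DecidableEq c] (Ξ : SuperMap a b c d)
    (E : OpMap c (m × a)) (D : OpMap (m × b) d)
    (h : ∀ N, Ξ N = D ∘ₗ idTensor m N ∘ₗ E)
    (W : Matrix c c ℂ) (Y : Matrix b b ℂ) (k k' : a) (s s' : d) :
    bipartiteMap Ξ (W ⊗ₖ Y) (k, s) (k', s') =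
      D ((Matrix.of fun x y => E W (x, k) (y, k')) ⊗ₖ Y) s s' := by
  have key : ((Matrix.of fun x y => E W (x, k) (y, k')) ⊗ₖ Y : Matrix (m × b) (m × b) ℂ) =
      ∑ x : c × b, ∑ y : c × b, (W x.1 y.1 * Y x.2 y.2) •
        idTensor m (unitMap k k' x.2 y.2) (E (Matrix.single x.1 y.1 1)) := by
    have hE : ∀ p q, E W p q = ∑ i, ∑ j, W i j * E (Matrix.single i j 1) p q := by
      intro p q
      conv_lhs => rw [Matrix.matrix_eq_sum_single W]
      simp only [map_sum, Matrix.sum_apply]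
      refine Finset.sum_congr rfl fun i _ => Finset.sum_congr rfl fun j _ => ?_
      rw [← mul_one (W i j), ← smul_eq_mul (W i j) 1, ← Matrix.smul_single, map_smul]
      simp
    ext ⟨p, t⟩ ⟨q, t'⟩
    simp only [Matrix.kroneckerMap_apply, Matrix.of_apply, Matrix.sum_apply, Matrix.smul_apply,
      hE, Fintype.sum_prod_type, idTensor, unitMap, LinearMap.coe_mk, AddHom.coe_mk, smul_eq_mul,
      Matrix.single_apply, Finset.sum_mul]
    refine Finset.sum_congr rfl fun i _ => ?_
    rw [Finset.sum_comm]
    refine Finset.sum_congr rfl fun j _ => ?_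
    simp [ite_and, mul_right_comm, mul_assoc]
  rw [key]
  simp [bipartiteMap, h, map_sum, Matrix.sum_apply]

/-- The discrete Wigner function of a superchannel,
`W_Ξ(u_A, v_D | u_C, v_B) = 1/(d_A d_D) Tr[(A_{u_A} ⊗ A_{v_D}) P(A_{u_C} ⊗ A_{v_B})]`. -/
def superWigner {A B C D : QSystem} (Ξ : SuperMap A.Basis B.Basis C.Basis D.Basis)
    (uA : A.Phase) (vD : D.Phase) (uC : C.Phase) (vB : B.Phase) : ℂ :=
  (1 / ((A.dim : ℂ) * (D.dim : ℂ))) *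
    ((A.phasePoint uA ⊗ₖ D.phasePoint vD) *
      bipartiteMap Ξ (C.phasePoint uC ⊗ₖ B.phasePoint vB)).trace

/-- CPWP superchannels: `(id_R ⊗ Ξ)(N)` is CPWP for all CPWP channels `N : RA → RB` and
all reference systems `R`. -/
def IsCPWPSuper {A B C D : QSystem} (Ξ : SuperMap A.Basis B.Basis C.Basis D.Basis) : Prop :=
  ∀ (R : QSystem) (N : OpMap (R.tensor A).Basis (R.tensor B).Basis),
    IsChannel N → IsCPWP (R.tensor A) (R.tensor B) N →
      IsCPWP (R.tensor C) (R.tensor D) (idTensorSuper R.Basis Ξ N)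

/-- A classical bipartite channel `p(x, y | z, w)` (non-negative, normalised) whose output `x`
cannot be signalled to from the input `w`: the marginal `∑_y p(x, y | z, w)` does not depend
on `w`. -/
def IsNonsignallingChannel {X Y Z W : Type} [Fintype X] [Fintype Y]
    (p : X → Y → Z → W → ℂ) : Prop :=
  (∀ x y z w, 0 ≤ p x y z w) ∧ (∀ z w, ∑ x, ∑ y, p x y z w = 1) ∧
    ∀ x z w w', ∑ y, p x y z w = ∑ y, p x y z w'

end

/-! ### Matrix entries of the phase-space point operators of one qudit -/

noncomputable section
namespace QSystem

/-! The operators `A_u` are an orthogonal basis of operator space: `Tr[A_u A_v] = d δ_{uv}` and `∑_u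
A_u ⊗ A_u` is `d` times the swap. They have trace one, sum to `d • 1`, factor over tensor products,
and are permuted by transposition. Hence `V = ∑ W_V(u) A_u`, and a linear map `N` acts on Wigner
functions through the kernel `W_{N(A_u)}(v)`. A channel is CPWP iff its kernel is non-negative: one
direction is the kernel formula with a spectator reference (`IsChannel.isCPWP`), the other tests `N`
on half of a maximally entangled state, whose Wigner function is non-negative
(`IsCPWP.wigner_nonneg`).

Every map `A → B` is a combination of the maps `X ↦ Tr[A_u X] A_v`, with coefficients given by its
kernel. So the kernel of `(id ⊗ Ξ)(N)` is the kernel of `N` contracted with `W_Ξ`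
(`wigner_idTensorSuper`), and `W_Ξ ≥ 0` makes `Ξ` CPWP. Conversely, with reference `R = AB`, the
channel `routeMap` is CPWP and its kernel can be made to select a single pair `(u_A, v_B)`, so that
one entry of `W_Ξ` is exposed up to a positive factor. The Choi operator carries the same numbers as
`W_Ξ`, scaled and relabelled by transposition.

The normalisation and non-signalling conditions are trace statements about `Ξ` on maps that need not
be positive. They follow because a superchannel sends every trace-annihilating linear map to a
trace-annihilating one (`IsSuperchannel.trace_apply_eq_zero`): up to splitting and scaling, such a
map is a perturbation of the depolarizing channel inside the set of channels. -/

theorem boostPhase_pow_val (d : ℕ) [NeZero d] (a : ZMod d) :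
    Complex.exp (2 * Real.pi * Complex.I / d) ^ a.val = ZMod.stdAddChar a := by
  rw [ZMod.stdAddChar_apply, ZMod.toCircle_apply, ← Complex.exp_nat_mul]
  congr 1
  ring

/-- The inverse of `2` modulo an odd number. -/
def half (d : ℕ) : ZMod d := ((d + 1) / 2 : ℕ)

theorem half_mul_two {d : ℕ} (hd : Odd d) : half d * 2 = 1 := by
  obtain ⟨k, rfl⟩ := hd
  have h : ((2 * k + 1 + 1) / 2 : ℕ) = k + 1 := by omega
  have h0 : (((2 * k + 1 : ℕ)) : ZMod (2 * k + 1)) = 0 := ZMod.natCast_self _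
  rw [half, h]
  push_cast at h0 ⊢
  linear_combination h0

/-- `τ = exp(2πi · ((d+1)/2) / d)`, so `τ` is the standard character at the inverse of two. All
phases then become values of one additive character on `ZMod d`. -/
theorem tau_zpow {d : ℕ} [NeZero d] (hd : Odd d) (n : ℤ) :
    Complex.exp ((d + 1) * Real.pi * Complex.I / d) ^ n =
      ZMod.stdAddChar ((n : ZMod d) * half d) := by
  obtain ⟨k, hk⟩ := hd
  have h : ((d + 1) / 2 : ℕ) = k + 1 := by omega
  have e : (n : ZMod d) * half d = ((n * (k + 1) : ℤ) : ZMod d) := by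
    rw [half, h]; push_cast; ring
  rw [e, ZMod.stdAddChar_coe, ← Complex.exp_int_mul]
  congr 1
  have : (d : ℂ) = 2 * k + 1 := by rw [hk]; push_cast; ring
  push_cast
  rw [show ((d : ℂ) + 1) = 2 * (k + 1) by rw [this]; ring]
  ring

theorem shiftX_pow_apply (d : ℕ) [NeZero d] (n : ℕ) (j k : ZMod d) :
    (shiftX d ^ n) j k = if j = k + n then 1 else 0 := by
  induction n generalizing j k with
  | zero => simp [Matrix.one_apply]
  | succ n ih =>
    have hx : ∀ m, shiftX d m k = if m = k + 1 then 1 else 0 := fun _ => rfl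
    rw [pow_succ, Matrix.mul_apply]
    simp only [ih, hx, mul_ite, mul_one, mul_zero]
    simp [add_assoc, add_comm (1 : ZMod d)]

theorem weyl_qudit_apply {d : ℕ} (hp : d.Prime) (ho : Odd d) [NeZero d] (u : ZMod d × ZMod d)
    (j k : ZMod d) :
    (qudit d hp ho).weyl u j k =
      if j = k + u.2 then ZMod.stdAddChar (u.1 * j - u.1 * u.2 * half d) else 0 := by
  have h : (qudit d hp ho).weyl u =
      (Complex.exp ((d + 1) * Real.pi * Complex.I / d) ^ (-((u.1.val * u.2.val : ℕ) : ℤ))) •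
      (boostZ d ^ u.1.val * shiftX d ^ u.2.val) := rfl
  rw [h, tau_zpow ho, boostZ, Matrix.diagonal_pow, Matrix.smul_apply, Matrix.diagonal_mul,
    shiftX_pow_apply]
  simp only [Pi.pow_apply, smul_eq_mul, ZMod.natCast_val, ZMod.cast_id', id_eq]
  split_ifs with hjk
  · rw [boostPhase_pow_val, ← AddChar.map_nsmul_eq_pow, mul_one, ← AddChar.map_add_eq_mul]
    congr 1
    push_cast
    simp
    ring
  · simp

theorem sum_stdAddChar_mul (d : ℕ) [NeZero d] (b : ZMod d) :
    ∑ x : ZMod d, (ZMod.stdAddChar (x * b) : ℂ) = if b = 0 then (d : ℂ) else 0 := by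
  have := AddChar.sum_mulShift b (ZMod.isPrimitive_stdAddChar d)
  simpa [ZMod.card] using this

theorem dim_qudit {d : ℕ} (hp : d.Prime) (ho : Odd d) : (qudit d hp ho).dim = d := by
  have : NeZero d := ⟨hp.ne_zero⟩
  exact ZMod.card d

/-- `A_0` is the parity operator. The shift forces `a₂ = j - k`, the remaining phase is `a₁(j +
k)/2`, and the character sum over `a₁` kills it unless `j + k = 0`. -/
theorem phasePointZero_qudit_apply {d : ℕ} (hp : d.Prime) (ho : Odd d) [NeZero d]
    (j k : ZMod d) :
    (qudit d hp ho).phasePointZero j k = if j + k = 0 then 1 else 0 := by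
  have hd : (d : ℂ) ≠ 0 := NeZero.ne _
  have h : (qudit d hp ho).phasePointZero j k =
      (1 / (d : ℂ)) * ∑ u : ZMod d × ZMod d, (qudit d hp ho).weyl u j k := by
    rw [phasePointZero, dim_qudit, Matrix.smul_apply, Matrix.sum_apply, smul_eq_mul]
  rw [h, Fintype.sum_prod_type]
  simp only [weyl_qudit_apply]
  have : ∀ x y : ZMod d, (if j = k + y then (ZMod.stdAddChar (x * j - x * y * half d) : ℂ) else 0) =
      if y = j - k then ZMod.stdAddChar (x * ((j + k) * half d)) else 0 := by
    intro x y
    by_cases hy : y = j - k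
    · subst hy
      rw [if_pos (by ring), if_pos rfl]
      congr 1
      linear_combination (-x * j) * half_mul_two ho
    · rw [if_neg hy, if_neg (fun h => hy (by rw [h]; ring))]
  simp only [this, Finset.sum_ite_eq', Finset.mem_univ, if_true, sum_stdAddChar_mul]
  have e : (j + k) * half d = 0 ↔ j + k = 0 := by
    constructor
    · intro h
      linear_combination 2 * h - (j + k) * half_mul_two ho
    · intro h; rw [h, zero_mul]
  simp only [e]
  split_ifs <;> simp [hd]

theorem phasePoint_qudit_apply {d : ℕ} (hp : d.Prime) (ho : Odd d) [NeZero d]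
    (u : ZMod d × ZMod d) (j k : ZMod d) :
    (qudit d hp ho).phasePoint u j k =
      if j + k = 2 * u.2 then ZMod.stdAddChar (u.1 * (j - k)) else 0 := by
  have h : (qudit d hp ho).phasePoint u j k = ∑ n : ZMod d, (∑ m : ZMod d,
      (qudit d hp ho).weyl u j m * (qudit d hp ho).phasePointZero m n) *
        star ((qudit d hp ho).weyl u k n) := by
    rw [phasePoint, Matrix.mul_apply]
    simp only [Matrix.mul_apply, Matrix.conjTranspose_apply]
  rw [h]
  simp only [weyl_qudit_apply, phasePointZero_qudit_apply]
  have e1 : ∀ n : ZMod d, (∑ m : ZMod d,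
      (if j = m + u.2 then (ZMod.stdAddChar (u.1 * j - u.1 * u.2 * half d) : ℂ) else 0) *
        (if m + n = 0 then 1 else 0)) =
      if j - u.2 + n = 0 then ZMod.stdAddChar (u.1 * j - u.1 * u.2 * half d) else 0 := by
    intro n
    rw [Finset.sum_eq_single (j - u.2)]
    · simp
    · intro m _ hm
      rw [if_neg (fun h => hm (by rw [h]; ring)), zero_mul]
    · simp
  simp only [e1]
  rw [Finset.sum_eq_single (k - u.2)]
  · have e2 : j - u.2 + (k - u.2) = 0 ↔ j + k = 2 * u.2 :=
      ⟨fun h => by linear_combination h, fun h => by linear_combination h⟩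
    simp only [e2, sub_add_cancel, if_true]
    split_ifs
    · rw [← starRingEnd_apply, ← AddChar.map_neg_eq_conj, ← AddChar.map_add_eq_mul]
      congr 1
      ring
    · rw [zero_mul]
  · intro n _ hn
    rw [if_neg (c := k = n + u.2) (fun h => hn (by rw [h]; ring)), star_zero, mul_zero]
  · simp

end QSystem
end

/-! ### Orthogonality and completeness of the phase-space point operators -/

noncomputable section
theorem sum_fst_mul_snd {α β : Type} [Fintype α] [Fintype β] (f : α → ℂ) (g : β → ℂ) :
    ∑ u : α × β, f u.1 * g u.2 = (∑ x, f x) * ∑ y, g y := by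
  rw [Fintype.sum_prod_type, Finset.sum_mul_sum]

namespace QSystem

instance instNonemptyBasis : (S : QSystem) → Nonempty S.Basis
  | trivial => ⟨()⟩
  | qudit d _ _ => ⟨(0 : ZMod d)⟩
  | tensor A B =>
    have := instNonemptyBasis A
    have := instNonemptyBasis B
    inferInstanceAs (Nonempty (A.Basis × B.Basis))

instance instDecidableEqPhase (S : QSystem) : DecidableEq S.Phase := Classical.decEq _

theorem dim_pos (S : QSystem) : 0 < S.dim := Fintype.card_pos

theorem dim_ne_zero (S : QSystem) : (S.dim : ℂ) ≠ 0 := Nat.cast_ne_zero.2 S.dim_pos.ne'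

theorem dim_tensor (A B : QSystem) : (A.tensor B).dim = A.dim * B.dim := Fintype.card_prod _ _

theorem phasePointZero_tensor (A B : QSystem) :
    (A.tensor B).phasePointZero = A.phasePointZero ⊗ₖ B.phasePointZero := by
  ext p q
  have h : (A.tensor B).phasePointZero p q = (1 / ((A.dim : ℂ) * B.dim)) *
      ∑ u : A.Phase × B.Phase, A.weyl u.1 p.1 q.1 * B.weyl u.2 p.2 q.2 := by
    rw [phasePointZero, dim_tensor, Matrix.smul_apply, Matrix.sum_apply, smul_eq_mul, Nat.cast_mul]
    rfl
  have h' : ∑ u : A.Phase × B.Phase, A.weyl u.1 p.1 q.1 * B.weyl u.2 p.2 q.2 =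
      (∑ u, A.weyl u p.1 q.1) * ∑ v, B.weyl v p.2 q.2 :=
    sum_fst_mul_snd (fun u => A.weyl u p.1 q.1) (fun v => B.weyl v p.2 q.2)
  rw [h, h', Matrix.kroneckerMap_apply, phasePointZero, phasePointZero, Matrix.smul_apply, Matrix.smul_apply, Matrix.sum_apply, Matrix.sum_apply,
    smul_eq_mul, smul_eq_mul]
  ring

theorem phasePoint_tensor (A B : QSystem) (u : A.Phase) (v : B.Phase) :
    (A.tensor B).phasePoint (u, v) = A.phasePoint u ⊗ₖ B.phasePoint v := by
  have h : (A.tensor B).weyl (u, v) = A.weyl u ⊗ₖ B.weyl v := rfl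
  rw [phasePoint, phasePointZero_tensor, h]
  refine Eq.trans ?_ (Eq.trans (congrArg₂ (· * ·)
    (Matrix.mul_kronecker_mul (A.weyl u) A.phasePointZero (B.weyl v) B.phasePointZero).symm
    (Matrix.conjTranspose_kronecker (A.weyl u) (B.weyl v))) ?_)
  · rfl
  · exact (Matrix.mul_kronecker_mul _ _ _ _).symm

theorem phasePoint_trivial (u : trivial.Phase) : trivial.phasePoint u = 1 := by
  have h0 : trivial.phasePointZero = 1 := by
    simp [phasePointZero, weyl, dim, Basis, Phase]
  simp [phasePoint, h0, weyl]

theorem two_mul_cancel_of_odd {d : ℕ} (ho : Odd d) {x y : ZMod d} (h : 2 * x = 2 * y) : x = y := by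
  linear_combination half d * h - (x - y) * half_mul_two ho

theorem trace_phasePoint : (S : QSystem) → (u : S.Phase) → (S.phasePoint u).trace = 1
  | trivial, u => by
    rw [phasePoint_trivial]
    simp [Matrix.trace]
  | qudit d hp ho, u => by
    have : NeZero d := ⟨hp.ne_zero⟩
    have h : ((qudit d hp ho).phasePoint u).trace =
        ∑ j : ZMod d, (qudit d hp ho).phasePoint u j j := rfl
    rw [h, Finset.sum_eq_single u.2]
    · rw [phasePoint_qudit_apply, if_pos (two_mul _).symm, sub_self, mul_zero, AddChar.map_zero_eq_one]
    · intro j _ hj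
      rw [phasePoint_qudit_apply, if_neg]
      exact fun h => hj (two_mul_cancel_of_odd ho ((two_mul j).trans h))
    · simp
  | tensor A B, (u, v) => by
    rw [phasePoint_tensor]
    exact (Matrix.trace_kronecker _ _).trans (by rw [trace_phasePoint A, trace_phasePoint B, one_mul])

/-- Transposition reverses the sign of the momentum coordinate. This absorbs the transposes that
Choi operators introduce. -/
theorem exists_phasePoint_eq_transpose : (S : QSystem) → (u : S.Phase) →
    ∃ v, S.phasePoint v = (S.phasePoint u)ᵀ
  | trivial, u => ⟨u, by rw [phasePoint_trivial, Matrix.transpose_one]⟩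
  | qudit d hp ho, u => by
    have : NeZero d := ⟨hp.ne_zero⟩
    refine ⟨(-u.1, u.2), ?_⟩
    ext j k
    rw [Matrix.transpose_apply, phasePoint_qudit_apply, phasePoint_qudit_apply]
    rw [add_comm j k, show -u.1 * (j - k) = u.1 * (k - j) by ring]
  | tensor A B, (u, v) => by
    obtain ⟨u', hu⟩ := exists_phasePoint_eq_transpose A u
    obtain ⟨v', hv⟩ := exists_phasePoint_eq_transpose B v
    refine ⟨(u', v'), ?_⟩
    rw [phasePoint_tensor, phasePoint_tensor, hu, hv]
    rfl

theorem trace_phasePoint_mul : (S : QSystem) → (u v : S.Phase) →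
    (S.phasePoint u * S.phasePoint v).trace = if u = v then (S.dim : ℂ) else 0
  | trivial, u, v => by
    rw [phasePoint_trivial u, if_pos rfl]
    simp [Matrix.trace, dim]
  | qudit d hp ho, u, v => by
    have : NeZero d := ⟨hp.ne_zero⟩
    have h : ((qudit d hp ho).phasePoint u * (qudit d hp ho).phasePoint v).trace =
        ∑ j : ZMod d, ∑ k : ZMod d,
          (qudit d hp ho).phasePoint u j k * (qudit d hp ho).phasePoint v k j := rfl
    have hj : ∀ j : ZMod d, ∑ k : ZMod d,
        (qudit d hp ho).phasePoint u j k * (qudit d hp ho).phasePoint v k j =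
        if u.2 = v.2 then ZMod.stdAddChar ((2 * j - 2 * u.2) * (u.1 - v.1)) else 0 := by
      intro j
      rw [Finset.sum_eq_single (2 * u.2 - j)]
      · rw [phasePoint_qudit_apply, phasePoint_qudit_apply, if_pos (by ring)]
        by_cases h2 : u.2 = v.2
        · rw [if_pos h2, if_pos (by rw [h2]; ring), ← AddChar.map_add_eq_mul]
          congr 1
          ring
        · rw [if_neg h2, if_neg, mul_zero]
          exact fun h => h2 (two_mul_cancel_of_odd ho (by linear_combination h))
      · intro k _ hk
        rw [phasePoint_qudit_apply, if_neg, zero_mul]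
        exact fun h => hk (by linear_combination h)
      · simp
    rw [h, Finset.sum_congr rfl fun j _ => hj j, dim_qudit]
    by_cases h2 : u.2 = v.2
    · simp only [if_pos h2]
      -- Doubling is a bijection of `ZMod d` for odd `d`, so the phases run over a full character
      -- sum.
      have e : ∑ j : ZMod d, (ZMod.stdAddChar ((2 * j - 2 * u.2) * (u.1 - v.1)) : ℂ) =
          ∑ x : ZMod d, (ZMod.stdAddChar (x * (u.1 - v.1)) : ℂ) := by
        refine Fintype.sum_bijective (fun j : ZMod d => 2 * j - 2 * u.2) ?_ _ _ fun _ => rfl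
        refine (Finite.injective_iff_bijective).1 fun x y hxy => ?_
        exact two_mul_cancel_of_odd ho (sub_left_injective hxy)
      rw [e, sum_stdAddChar_mul]
      simp only [sub_eq_zero, Prod.ext_iff, h2, and_true]
    · simp only [if_neg h2, Finset.sum_const_zero]
      rw [if_neg fun h => h2 (congrArg Prod.snd h)]
  | tensor A B, (u, v), (u', v') => by
    rw [phasePoint_tensor, phasePoint_tensor]
    refine (congrArg Matrix.trace (Matrix.mul_kronecker_mul _ _ _ _).symm).trans
      ((Matrix.trace_kronecker _ _).trans ?_)
    rw [trace_phasePoint_mul A, trace_phasePoint_mul B, dim_tensor]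
    by_cases h1 : u = u' <;> by_cases h2 : v = v' <;> simp [h1, h2]

/-- Completeness, dual to `trace_phasePoint_mul`: `∑_u A_u ⊗ A_u` is `d` times the swap. For a
qudit, the position sum equates the midpoints of `(j, k)` and `(m, n)`, and the momentum sum equates
the differences `j - k` and `n - m`. -/
theorem sum_phasePoint_mul : (S : QSystem) → (j k m n : S.Basis) →
    ∑ u, S.phasePoint u j k * S.phasePoint u m n =
      if j = n ∧ k = m then (S.dim : ℂ) else 0
  | trivial, j, k, m, n => by
    rw [if_pos ⟨rfl, rfl⟩]
    simp only [phasePoint_trivial]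
    simp [dim]
  | qudit d hp ho, j, k, m, n => by
    have : NeZero d := ⟨hp.ne_zero⟩
    have h : ∑ u, (qudit d hp ho).phasePoint u j k * (qudit d hp ho).phasePoint u m n =
        ∑ u : ZMod d × ZMod d,
          (qudit d hp ho).phasePoint u j k * (qudit d hp ho).phasePoint u m n := rfl
    rw [h, dim_qudit, Fintype.sum_prod_type]
    have hx : ∀ x : ZMod d, ∑ y : ZMod d,
        (qudit d hp ho).phasePoint (x, y) j k * (qudit d hp ho).phasePoint (x, y) m n =
        if j + k = m + n then ZMod.stdAddChar (x * (j - k + (m - n))) else 0 := by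
      intro x
      have hh := half_mul_two ho
      rw [Finset.sum_eq_single (half d * (j + k))]
      · rw [phasePoint_qudit_apply, phasePoint_qudit_apply,
          if_pos (by linear_combination -(j + k) * hh)]
        by_cases h2 : j + k = m + n
        · rw [if_pos h2, if_pos (by linear_combination -(j + k) * hh - h2),
            ← AddChar.map_add_eq_mul, ← mul_add]
        · rw [if_neg h2, if_neg, mul_zero]
          exact fun h => h2 (by linear_combination -(j + k) * hh - h)
      · intro y _ hy
        rw [phasePoint_qudit_apply, if_neg, zero_mul]
        exact fun h => hy (by linear_combination -half d * h - y * hh)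
      · simp
    rw [Finset.sum_congr rfl fun x _ => hx x]
    by_cases h2 : j + k = m + n
    · simp only [if_pos h2, sum_stdAddChar_mul]
      have e : j - k + (m - n) = 0 ↔ j = n ∧ k = m := by
        constructor
        · intro h
          constructor <;> apply two_mul_cancel_of_odd ho
          · linear_combination h + h2
          · linear_combination h2 - h
        · rintro ⟨rfl, rfl⟩
          ring
      simp only [e]
    · rw [if_neg fun h => h2 (by rw [h.1, h.2, add_comm])]
      simp only [if_neg h2, Finset.sum_const_zero]
  | tensor A B, (j, j'), (k, k'), (m, m'), (n, n') => by
    have h : ∑ u, (A.tensor B).phasePoint u (j, j') (k, k') *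
          (A.tensor B).phasePoint u (m, m') (n, n') =
        ∑ u : A.Phase × B.Phase, (A.phasePoint u.1 j k * A.phasePoint u.1 m n) *
          (B.phasePoint u.2 j' k' * B.phasePoint u.2 m' n') := by
      refine Finset.sum_congr rfl fun u _ => ?_
      rw [phasePoint_tensor]
      exact mul_mul_mul_comm _ _ _ _
    rw [h]
    refine (sum_fst_mul_snd (fun u => A.phasePoint u j k * A.phasePoint u m n)
      (fun v => B.phasePoint v j' k' * B.phasePoint v m' n')).trans ?_
    rw [sum_phasePoint_mul A, sum_phasePoint_mul B,
      dim_tensor]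
    by_cases h1 : j = n <;> by_cases h2 : j' = n' <;> by_cases h3 : k = m <;>
      by_cases h4 : k' = m' <;> simp [h1, h2, h3, h4]

/-- Every operator is the combination of phase-space point operators given by its Wigner function. -/
theorem eq_sum_wigner_smul_phasePoint (S : QSystem) (V : S.Op) :
    V = ∑ u, S.wigner V u • S.phasePoint u := by
  ext j k
  have h : ∀ u, (S.wigner V u • S.phasePoint u) j k = (1 / (S.dim : ℂ)) *
      ∑ m, ∑ n, (S.phasePoint u j k * S.phasePoint u m n) * V n m := by
    intro u
    rw [Matrix.smul_apply, wigner, Matrix.trace, smul_eq_mul, mul_assoc, Finset.sum_mul]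
    congr 1
    refine Finset.sum_congr rfl fun m _ => ?_
    rw [Matrix.diag_apply, Matrix.mul_apply, Finset.sum_mul]
    exact Finset.sum_congr rfl fun n _ => by ring
  rw [Matrix.sum_apply, Finset.sum_congr rfl fun u _ => h u, ← Finset.mul_sum, Finset.sum_comm,
    Finset.sum_congr rfl fun m _ => Finset.sum_comm]
  simp only [← Finset.sum_mul, sum_phasePoint_mul, ite_and, ite_mul, zero_mul]
  simp [S.dim_ne_zero]

theorem sum_phasePoint (S : QSystem) : ∑ u, S.phasePoint u = (S.dim : ℂ) • 1 := by
  ext j k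
  -- Inserting `Tr A_u = 1` makes the sum a trace of the completeness relation.
  have h : ∀ u, S.phasePoint u j k = ∑ m, S.phasePoint u j k * S.phasePoint u m m := by
    intro u
    rw [← Finset.mul_sum]
    have := S.trace_phasePoint u
    rw [Matrix.trace] at this
    simp only [Matrix.diag_apply] at this
    rw [this, mul_one]
  rw [Matrix.sum_apply, Finset.sum_congr rfl fun u _ => h u, Finset.sum_comm]
  simp only [sum_phasePoint_mul, ite_and]
  simp [Matrix.one_apply, eq_comm]

end QSystem
end

/-! ### Partial contractions, Choi operators and supermaps -/

noncomputable section

/-- The partial contraction `Tr_R[(F ⊗ 1) X]`. -/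
def partialContract {r a : Type} [Fintype r] (F : Matrix r r ℂ) (X : Matrix (r × a) (r × a) ℂ) :
    Matrix a a ℂ :=
  Matrix.of fun i j => ∑ p, ∑ q, F p q * X (q, i) (p, j)

theorem trace_kronecker_mul {r a : Type} [Fintype r] [Fintype a] (F : Matrix r r ℂ)
    (G : Matrix a a ℂ) (X : Matrix (r × a) (r × a) ℂ) :
    ((F ⊗ₖ G) * X).trace = (G * partialContract F X).trace := by
  simp only [Matrix.trace, Matrix.diag_apply, Matrix.mul_apply, partialContract, Matrix.of_apply,
    Fintype.sum_prod_type, Matrix.kroneckerMap_apply, Finset.mul_sum]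
  rw [Finset.sum_comm]
  refine Finset.sum_congr rfl fun i _ => ?_
  rw [Finset.sum_congr rfl fun p _ => Finset.sum_comm, Finset.sum_comm]
  refine Finset.sum_congr rfl fun j _ => Finset.sum_congr rfl fun p _ =>
    Finset.sum_congr rfl fun q _ => by ring

theorem partialContract_idTensor {r a b : Type} [Fintype r] (F : Matrix r r ℂ) (N : OpMap a b)
    (X : Matrix (r × a) (r × a) ℂ) :
    partialContract F (idTensor r N X) = N (partialContract F X) := by
  have h : partialContract F X =
      ∑ p, ∑ q, F p q • (Matrix.of fun i j => X (q, i) (p, j) : Matrix a a ℂ) := by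
    ext i j
    simp [partialContract, Matrix.sum_apply]
  rw [h]
  ext i j
  simp only [partialContract, Matrix.of_apply, idTensor, LinearMap.coe_mk, AddHom.coe_mk, map_sum,
    map_smul, Matrix.sum_apply, Matrix.smul_apply, smul_eq_mul]

theorem apply_eq_sum_single {a b : Type} [Fintype a] [DecidableEq a] (N : OpMap a b)
    (X : Matrix a a ℂ) : N X = ∑ i, ∑ j, X i j • N (Matrix.single i j 1) := by
  conv_lhs => rw [Matrix.matrix_eq_sum_single X]
  simp only [map_sum, ← map_smul, Matrix.smul_single, smul_eq_mul, mul_one]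

theorem choi_apply {a b : Type} [Fintype a] [DecidableEq a] (N : OpMap a b) (p q : a × b) :
    choi N p q = N (Matrix.single p.1 q.1 1) p.2 q.2 := by
  simp only [choi, Matrix.sum_apply, Matrix.kroneckerMap_apply, Matrix.single_apply]
  simp [ite_and]

theorem partialContract_choi {a b : Type} [Fintype a] [DecidableEq a] (N : OpMap a b)
    (F : Matrix a a ℂ) : partialContract F (choi N) = N Fᵀ := by
  rw [apply_eq_sum_single N Fᵀ, Finset.sum_comm]
  ext i j
  simp [partialContract, choi_apply, Matrix.sum_apply]

/-- The measure-and-prepare map `X ↦ Tr[F X] Y`. -/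
def measPrep {a b : Type} [Fintype a] (F : Matrix a a ℂ) (Y : Matrix b b ℂ) : OpMap a b where
  toFun X := (F * X).trace • Y
  map_add' X X' := by rw [Matrix.mul_add, Matrix.trace_add, add_smul]
  map_smul' c X := by rw [Matrix.mul_smul, Matrix.trace_smul, smul_assoc, RingHom.id_apply]

theorem measPrep_apply {a b : Type} [Fintype a] (F : Matrix a a ℂ) (Y : Matrix b b ℂ)
    (X : Matrix a a ℂ) : measPrep F Y X = (F * X).trace • Y := rfl

theorem measPrep_eq_sum {a b : Type} [Fintype a] [Fintype b] [DecidableEq b]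
    (F : Matrix a a ℂ) (Y : Matrix b b ℂ) :
    measPrep F Y = ∑ k, ∑ k', ∑ l, ∑ l', (F k' k * Y l l') • unitMap k k' l l' := by
  ext X m n
  simp only [LinearMap.sum_apply, LinearMap.smul_apply, measPrep_apply, Matrix.smul_apply,
    Matrix.sum_apply, unitMap, LinearMap.coe_mk, AddHom.coe_mk, Matrix.single_apply]
  simp only [ite_and, smul_eq_mul, mul_ite, mul_one, mul_zero,
    Matrix.trace, Matrix.diag_apply, Matrix.mul_apply, Finset.sum_mul]
  rw [Finset.sum_comm]
  refine Finset.sum_congr rfl fun k _ => Finset.sum_congr rfl fun k' _ => ?_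
  simp
  ring

theorem bipartiteMap_kronecker_apply {a b c d : Type} [Fintype b] [DecidableEq b]
    [Fintype c] [DecidableEq c] (Ξ : SuperMap a b c d)
    (V : Matrix c c ℂ) (Y : Matrix b b ℂ) (k k' : a) (s s' : d) :
    bipartiteMap Ξ (V ⊗ₖ Y) (k, s) (k', s') =
      Ξ (∑ l, ∑ l', Y l l' • unitMap k k' l l') V s s' := by
  rw [apply_eq_sum_single _ V]
  simp only [bipartiteMap, LinearMap.coe_mk, AddHom.coe_mk, Matrix.of_apply,
    Fintype.sum_prod_type, Matrix.kroneckerMap_apply, map_sum, map_smul, LinearMap.sum_apply,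
    LinearMap.smul_apply, Matrix.sum_apply, Matrix.smul_apply, smul_eq_mul, Finset.mul_sum,
    mul_assoc]
  refine Finset.sum_congr rfl fun i _ => ?_
  rw [Finset.sum_comm]

/-- Bridge from `bipartiteMap` to `Ξ` itself: contracting the `A` output with `F` and feeding `Y`
into `B` amounts to plugging a measure-and-prepare map into `Ξ`. -/
theorem trace_kronecker_mul_bipartiteMap {a b c d : Type} [Fintype a] [Fintype b] [DecidableEq b]
    [Fintype c] [DecidableEq c] [Fintype d] (Ξ : SuperMap a b c d)
    (F : Matrix a a ℂ) (G : Matrix d d ℂ) (V : Matrix c c ℂ) (Y : Matrix b b ℂ) :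
    ((F ⊗ₖ G) * bipartiteMap Ξ (V ⊗ₖ Y)).trace = (G * Ξ (measPrep F Y) V).trace := by
  rw [trace_kronecker_mul]
  congr 2
  ext s s'
  rw [measPrep_eq_sum, Finset.sum_comm]
  simp only [partialContract, Matrix.of_apply, bipartiteMap_kronecker_apply, map_sum, map_smul,
    LinearMap.sum_apply, LinearMap.smul_apply, Matrix.sum_apply, Matrix.smul_apply, smul_eq_mul,
    Finset.mul_sum, mul_assoc]

theorem partialContract_kronecker {r a : Type} [Fintype r] (F G : Matrix r r ℂ) (Y : Matrix a a ℂ) :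
    partialContract F (G ⊗ₖ Y) = (F * G).trace • Y := by
  ext i j
  simp [partialContract, Matrix.trace, Matrix.mul_apply, Finset.sum_mul, mul_assoc]

/-- The map `X ↦ Tr_R[(F ⊗ 1) N(G ⊗ X)]`. -/
def contractMap {r a b : Type} [Fintype r] (F G : Matrix r r ℂ)
    (N : OpMap (r × a) (r × b)) : OpMap a b where
  toFun X := partialContract F (N (G ⊗ₖ X))
  map_add' X X' := by
    ext i j
    simp [partialContract, Matrix.kronecker_add, mul_add, Finset.sum_add_distrib]
  map_smul' c X := by
    ext i j
    simp [partialContract, Matrix.kronecker_smul, Finset.mul_sum, mul_left_comm]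

theorem contractMap_eq_sum {r a b : Type} [Fintype r] [DecidableEq r] (F G : Matrix r r ℂ)
    (N : OpMap (r × a) (r × b)) :
    contractMap F G N = ∑ s', ∑ s, ∑ i, ∑ i', (F s' s * G i i') • refBlock N i i' s s' := by
  ext X k l
  have hG : G ⊗ₖ X = ∑ i, ∑ i', G i i' • (Matrix.single i i' (1 : ℂ) ⊗ₖ X) := by
    ext p q
    simp [Matrix.sum_apply, Matrix.single_apply, ite_and]
  simp only [contractMap, LinearMap.coe_mk, AddHom.coe_mk, hG, map_sum, map_smul, partialContract,
    Matrix.of_apply, LinearMap.sum_apply, LinearMap.smul_apply, Matrix.sum_apply,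
    Matrix.smul_apply, refBlock, smul_eq_mul, Finset.mul_sum, mul_assoc]

/-- `id ⊗ Ξ` acts blockwise and `Ξ` is linear, so fixing the reference input and contracting the
reference output may be done before `Ξ` is applied. -/
theorem partialContract_idTensorSuper {r a b c d : Type} [Fintype r] [DecidableEq r]
    (Ξ : SuperMap a b c d) (N : OpMap (r × a) (r × b)) (F G : Matrix r r ℂ) (V : Matrix c c ℂ) :
    partialContract F (idTensorSuper r Ξ N (G ⊗ₖ V)) = Ξ (contractMap F G N) V := by
  rw [contractMap_eq_sum]
  have hV : ∀ i i', (Matrix.of fun k l => (G ⊗ₖ V) (i, k) (i', l) : Matrix c c ℂ) =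
      G i i' • V := fun i i' => by ext; simp
  ext k l
  simp only [partialContract, Matrix.of_apply, idTensorSuper, LinearMap.coe_mk, AddHom.coe_mk,
    hV, map_sum, map_smul, LinearMap.sum_apply, LinearMap.smul_apply, Matrix.sum_apply,
    Matrix.smul_apply, smul_eq_mul, Finset.mul_sum, mul_assoc]

end

/-! ### Complete positivity, and traces under a superchannel -/

noncomputable section

open scoped MatrixOrder Matrix.Norms.L2Operator in
theorem exists_posSemidef_add_smul_one {n : Type} [Fintype n] [DecidableEq n] {H : Matrix n n ℂ}
    (hH : H.IsHermitian) : ∃ c : ℝ, 0 < c ∧ (H + (c : ℂ) • 1).PosSemidef := by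
  have h : -algebraMap ℝ (Matrix n n ℂ) ‖H‖ ≤ H :=
    IsSelfAdjoint.neg_algebraMap_norm_le_self hH.isSelfAdjoint
  rw [Matrix.le_iff] at h
  -- The extra `1` keeps the constant positive even for `H = 0`; it is inverted later.
  refine ⟨‖H‖ + 1, by positivity, ?_⟩
  have e : H + ((‖H‖ + 1 : ℝ) : ℂ) • 1 = H - -algebraMap ℝ (Matrix n n ℂ) ‖H‖ + 1 := by
    rw [Algebra.algebraMap_eq_smul_one]
    ext i j
    simp [add_mul]
    ring
  rw [e]
  exact h.add Matrix.PosSemidef.one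

/-- `(id ⊗ N)(X)` is a compression of `X ⊗ J^N`: the submatrix identifies the two copies of `a`, and
`S` sums over the common index. -/
theorem isCompletelyPositive_of_choi {a b : Type} [Fintype a] [DecidableEq a] [Fintype b]
    [DecidableEq b] {N : OpMap a b} (hN : (choi N).PosSemidef) : IsCompletelyPositive N := by
  intro r _ _ X hX
  have hY := (hX.kronecker hN).submatrix
    (fun x : a × (r × b) => ((x.2.1, x.1), (x.1, x.2.2)))
  let S : Matrix (r × b) (a × (r × b)) ℂ := Matrix.of fun x y => if x = y.2 then 1 else 0
  have hB := hY.mul_mul_conjTranspose_same S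
  refine (?_ : _ = idTensor r N X) ▸ hB
  symm
  ext p q
  simp only [idTensor, LinearMap.coe_mk, AddHom.coe_mk, Matrix.of_apply]
  rw [apply_eq_sum_single]
  simp only [Matrix.sum_apply, Matrix.smul_apply, Matrix.of_apply, smul_eq_mul, Matrix.mul_apply,
    Matrix.conjTranspose_apply, S, Matrix.submatrix_apply, Matrix.kroneckerMap_apply, choi_apply,
    Fintype.sum_prod_type (α₁ := a), apply_ite star, star_one, star_zero, mul_ite, mul_one,
    mul_zero, ite_mul, one_mul, zero_mul, Finset.sum_ite_eq, Finset.mem_univ, if_true]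
  exact Finset.sum_comm

theorem IsCompletelyPositive.posSemidef_apply {a b : Type} {N : OpMap a b}
    (hN : IsCompletelyPositive N) {X : Matrix a a ℂ} (hX : X.PosSemidef) : (N X).PosSemidef :=
  (hN Unit (X.submatrix Prod.snd Prod.snd) (hX.submatrix _)).submatrix fun k => ((), k)

theorem IsCompletelyPositive.isHermiticityPreserving {a b : Type} [Fintype a] [DecidableEq a]
    {N : OpMap a b} (hN : IsCompletelyPositive N) : IsHermiticityPreserving N := by
  intro X hX
  obtain ⟨c, -, hc⟩ := exists_posSemidef_add_smul_one hX
  have h1 := (hN.posSemidef_apply hc).isHermitian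
  have h2 := (hN.posSemidef_apply (Matrix.PosSemidef.one (n := a) (R := ℂ))).isHermitian
  have h : N X = N (X + (c : ℂ) • 1) - (c : ℂ) • N 1 := by simp
  rw [h]
  refine h1.sub ?_
  rw [Matrix.IsHermitian, Matrix.conjTranspose_smul, h2.eq]
  simp

theorem IsCompletelyPositive.idTensor {a b : Type} {N : OpMap a b} (hN : IsCompletelyPositive N)
    (r : Type) [Fintype r] [DecidableEq r] : IsCompletelyPositive (idTensor r N) := by
  intro s _ _ X hX
  exact (hN (s × r) (X.submatrix (fun x => (x.1.1, (x.1.2, x.2))) fun x => (x.1.1, (x.1.2, x.2)))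
    (hX.submatrix _)).submatrix fun x : s × (r × b) => ((x.1, x.2.1), x.2.2)

theorem trace_idTensor {a b : Type} [Fintype a] [Fintype b] {N : OpMap a b}
    (hN : ∀ X, (N X).trace = X.trace) {r : Type} [Fintype r] (X : Matrix (r × a) (r × a) ℂ) :
    (idTensor r N X).trace = X.trace := by
  have h : ∀ p, ∑ k, N (Matrix.of fun i j => X (p, i) (p, j)) k k = ∑ k, X (p, k) (p, k) :=
    fun p => hN (Matrix.of fun i j => X (p, i) (p, j))
  simp only [Matrix.trace, Matrix.diag_apply, Fintype.sum_prod_type]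
  exact Finset.sum_congr rfl fun p _ => h p

theorem IsChannel.idTensor {a b : Type} [Fintype a] [Fintype b] {N : OpMap a b}
    (hN : IsChannel N) (r : Type) [Fintype r] [DecidableEq r] : IsChannel (idTensor r N) :=
  ⟨hN.1.idTensor r, trace_idTensor hN.2⟩

theorem choi_measPrep_one {a b : Type} [Fintype a] [DecidableEq a] (Y : Matrix b b ℂ) :
    choi (measPrep (1 : Matrix a a ℂ) Y) = 1 ⊗ₖ Y := by
  ext p q
  rw [choi_apply, measPrep_apply, one_mul, Matrix.smul_apply, Matrix.kroneckerMap_apply]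
  by_cases h : p.1 = q.1
  · rw [h, Matrix.trace_single_eq_same, Matrix.one_apply_eq, smul_eq_mul]
  · rw [Matrix.trace_single_eq_of_ne _ _ _ h, Matrix.one_apply_ne h, smul_eq_mul]

theorem choi_add {a b : Type} [Fintype a] [DecidableEq a] (N N' : OpMap a b) :
    choi (N + N') = choi N + choi N' := by
  ext p q
  simp [choi_apply]

theorem choi_smul {a b : Type} [Fintype a] [DecidableEq a] (t : ℂ) (N : OpMap a b) :
    choi (t • N) = t • choi N := by
  ext p q
  simp [choi_apply]

namespace IsSuperchannel

variable {a b c d : Type} [Fintype a] [Fintype b] [Fintype c] [Fintype d] {Ξ : SuperMap a b c d}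

/-- The definition speaks only of `id_R ⊗ Ξ`; the one-dimensional reference recovers `Ξ`. -/
theorem trace_apply_of_isChannel (hΞ : IsSuperchannel Ξ) {N : OpMap a b} (hN : IsChannel N)
    (W : Matrix c c ℂ) : (Ξ N W).trace = W.trace := by
  have h := (hΞ Unit _ (hN.idTensor Unit)).2 (W.submatrix Prod.snd Prod.snd)
  have hb : refBlock (idTensor Unit N) () () () () = N := by
    ext X k l
    simp only [refBlock, idTensor, LinearMap.coe_mk, AddHom.coe_mk, Matrix.of_apply,
      Matrix.kroneckerMap_apply, Matrix.single_apply_same, one_mul]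
    rfl
  simp only [Matrix.trace, Matrix.diag_apply, Fintype.sum_prod_type, idTensorSuper,
    LinearMap.coe_mk, AddHom.coe_mk, Matrix.of_apply, Finset.univ_unique, Finset.sum_singleton,
    Matrix.submatrix_apply] at h
  exact (congrArg (fun M => (Ξ M W).trace) hb).symm.trans h

variable [DecidableEq a] [DecidableEq b] [Nonempty b]

theorem isChannel_depolarizing : IsChannel (measPrep (1 : Matrix a a ℂ)
    ((Fintype.card b : ℂ)⁻¹ • (1 : Matrix b b ℂ))) := by
  constructor
  · apply isCompletelyPositive_of_choi
    rw [choi_measPrep_one]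
    exact Matrix.PosSemidef.one.kronecker (Matrix.PosSemidef.one.smul (by positivity))
  · intro X
    have : (Fintype.card b : ℂ) ≠ 0 := Nat.cast_ne_zero.2 Fintype.card_ne_zero
    simp [measPrep_apply, Matrix.trace_smul, this]

/-- The Choi operator of `N` is Hermitian, so depolarizing plus a small multiple of `N` is still a
channel. `Ξ` preserves trace on it and on the depolarizing channel, which leaves zero for `N`. -/
theorem trace_apply_eq_zero_of_conj (hΞ : IsSuperchannel Ξ) {N : OpMap a b}
    (hN : ∀ X, (N X).trace = 0) (hc : ∀ X, N Xᴴ = (N X)ᴴ) (W : Matrix c c ℂ) :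
    (Ξ N W).trace = 0 := by
  have hH : (choi N).IsHermitian := by
    ext p q
    rw [Matrix.conjTranspose_apply, choi_apply, choi_apply, ← Matrix.conjTranspose_apply, ← hc,
      Matrix.conjTranspose_single, star_one]
  obtain ⟨t, ht, hp⟩ := exists_posSemidef_add_smul_one hH
  have hb : (Fintype.card b : ℂ) ≠ 0 := Nat.cast_ne_zero.2 Fintype.card_ne_zero
  have ht' : (t : ℂ) ≠ 0 := by exact_mod_cast ht.ne'
  -- Chosen so that `s * t` is the coefficient of `1` in the Choi operator of the depolarizing
  -- channel.
  set s : ℂ := (Fintype.card b : ℂ)⁻¹ * (t : ℂ)⁻¹ with hs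
  have hs0 : 0 ≤ s := mul_nonneg (by positivity) (by
    rw [← Complex.ofReal_inv]; exact_mod_cast (inv_pos.2 ht).le)
  have hD := isChannel_depolarizing (a := a) (b := b)
  have hM : IsChannel (s • N + measPrep (1 : Matrix a a ℂ)
      ((Fintype.card b : ℂ)⁻¹ • (1 : Matrix b b ℂ))) := by
    constructor
    · apply isCompletelyPositive_of_choi
      rw [choi_add, choi_measPrep_one, choi_smul, Matrix.kronecker_smul, Matrix.one_kronecker_one]
      convert hp.smul hs0 using 1
      rw [smul_add, smul_smul, hs, mul_assoc, inv_mul_cancel₀ ht', mul_one]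
    · intro X
      rw [LinearMap.add_apply, Matrix.trace_add, hD.2, LinearMap.smul_apply, Matrix.trace_smul, hN]
      simp
  have h1 := hΞ.trace_apply_of_isChannel hM W
  rw [map_add, map_smul, LinearMap.add_apply, Matrix.trace_add, hΞ.trace_apply_of_isChannel hD,
    LinearMap.smul_apply, Matrix.trace_smul, add_eq_right, smul_eq_mul] at h1
  exact (mul_eq_zero.1 h1).resolve_left (mul_ne_zero (inv_ne_zero hb) (inv_ne_zero ht'))

end IsSuperchannel

/-- The map `X ↦ N(X†)†`. -/
def conjMap {a b : Type} (N : OpMap a b) : OpMap a b where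
  toFun X := (N Xᴴ)ᴴ
  map_add' X Y := by simp
  map_smul' t X := by simp [Matrix.conjTranspose_smul]

theorem conjMap_apply {a b : Type} (N : OpMap a b) (X : Matrix a a ℂ) :
    conjMap N X = (N Xᴴ)ᴴ := rfl

namespace IsSuperchannel

variable {a b c d : Type} [Fintype a] [Fintype b] [Fintype c] [Fintype d] {Ξ : SuperMap a b c d}
  [DecidableEq a] [DecidableEq b] [Nonempty b]

/-- Both `N + conjMap N` and `i(N - conjMap N)` commute with the adjoint, and `N` is a complex
combination of them. -/
theorem trace_apply_eq_zero (hΞ : IsSuperchannel Ξ) {N : OpMap a b}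
    (hN : ∀ X, (N X).trace = 0) (W : Matrix c c ℂ) : (Ξ N W).trace = 0 := by
  have hN' : ∀ X, (conjMap N X).trace = 0 := fun X => by
    rw [conjMap_apply, Matrix.trace_conjTranspose, hN, star_zero]
  have h1 : (Ξ (N + conjMap N) W).trace = 0 := by
    refine hΞ.trace_apply_eq_zero_of_conj (fun X => ?_) (fun X => ?_) W
    · rw [LinearMap.add_apply, Matrix.trace_add, hN, hN', add_zero]
    · simp [conjMap_apply, add_comm]
  have h2 : (Ξ (Complex.I • (N - conjMap N)) W).trace = 0 := by
    refine hΞ.trace_apply_eq_zero_of_conj (fun X => ?_) (fun X => ?_) W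
    · rw [LinearMap.smul_apply, Matrix.trace_smul, LinearMap.sub_apply, Matrix.trace_sub, hN, hN']
      simp
    · simp [conjMap_apply, Matrix.conjTranspose_smul, ← smul_neg]
  rw [map_add, LinearMap.add_apply, Matrix.trace_add] at h1
  rw [map_smul, LinearMap.smul_apply, Matrix.trace_smul, map_sub, LinearMap.sub_apply,
    Matrix.trace_sub, smul_eq_mul, mul_eq_zero, or_iff_right Complex.I_ne_zero] at h2
  linear_combination (h1 + h2) / 2

/-- No positivity is asked of `N`: the maps `X ↦ Tr[X] A_v` to which this is applied need not be
positive. -/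
theorem trace_apply_of_trace (hΞ : IsSuperchannel Ξ) {N : OpMap a b}
    (hN : ∀ X, (N X).trace = X.trace) (W : Matrix c c ℂ) : (Ξ N W).trace = W.trace := by
  have hD := isChannel_depolarizing (a := a) (b := b)
  have h := hΞ.trace_apply_eq_zero (N := N - measPrep (1 : Matrix a a ℂ)
    ((Fintype.card b : ℂ)⁻¹ • (1 : Matrix b b ℂ))) (fun X => by
      rw [LinearMap.sub_apply, Matrix.trace_sub, hN, hD.2, sub_self]) W
  rwa [map_sub, LinearMap.sub_apply, Matrix.trace_sub, hΞ.trace_apply_of_isChannel hD,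
    sub_eq_zero] at h

end IsSuperchannel
end

/-! ### Wigner kernels of maps and supermaps -/

noncomputable section
namespace QSystem

theorem one_div_dim_nonneg (S : QSystem) : 0 ≤ 1 / (S.dim : ℂ) := by positivity

theorem wigner_smul (S : QSystem) (t : ℂ) (X : S.Op) (u : S.Phase) :
    S.wigner (t • X) u = t * S.wigner X u := by
  rw [wigner, Matrix.mul_smul, Matrix.trace_smul, smul_eq_mul, mul_left_comm]; rfl

theorem wigner_sum (S : QSystem) {ι : Type} (s : Finset ι) (X : ι → S.Op) (u : S.Phase) :
    S.wigner (∑ i ∈ s, X i) u = ∑ i ∈ s, S.wigner (X i) u := by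
  simp only [wigner, Matrix.trace_sum, Finset.mul_sum]

theorem sum_wigner (S : QSystem) (X : S.Op) : ∑ u, S.wigner X u = X.trace := by
  simp only [wigner]
  rw [← Finset.mul_sum, ← Matrix.trace_sum, ← Finset.sum_mul, sum_phasePoint, Matrix.smul_mul,
    one_mul, Matrix.trace_smul, smul_eq_mul, ← mul_assoc, one_div, inv_mul_cancel₀ S.dim_ne_zero,
    one_mul]

theorem trace_phasePoint_mul_nonneg (S : QSystem) (u v : S.Phase) :
    0 ≤ (S.phasePoint u * S.phasePoint v).trace := by
  rw [trace_phasePoint_mul]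
  split_ifs
  · positivity
  · exact le_rfl

theorem wigner_phasePoint (S : QSystem) (u v : S.Phase) :
    S.wigner (S.phasePoint v) u = if u = v then 1 else 0 := by
  rw [wigner, trace_phasePoint_mul]
  split_ifs
  · rw [one_div, inv_mul_cancel₀ S.dim_ne_zero]
  · rw [mul_zero]

theorem wigner_tensor (R A : QSystem) (X : (R.tensor A).Op) (r : R.Phase) (u : A.Phase) :
    (R.tensor A).wigner X (r, u) =
      1 / (R.dim : ℂ) * A.wigner (partialContract (R.phasePoint r) X) u := by
  rw [wigner, phasePoint_tensor, dim_tensor, wigner, Nat.cast_mul]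
  refine (congrArg _ (trace_kronecker_mul (R.phasePoint r) (A.phasePoint u) X)).trans ?_
  ring

theorem wigner_kronecker (R A : QSystem) (X : R.Op) (Y : A.Op) (r : R.Phase) (u : A.Phase) :
    (R.tensor A).wigner (X ⊗ₖ Y) (r, u) = R.wigner X r * A.wigner Y u := by
  rw [wigner_tensor, partialContract_kronecker, wigner_smul, ← mul_assoc]
  rfl

theorem wigner_apply_eq_sum (A B : QSystem) (N : OpMap A.Basis B.Basis) (X : A.Op) (v : B.Phase) :
    B.wigner (N X) v = ∑ u, A.wigner X u * B.wigner (N (A.phasePoint u)) v := by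
  conv_lhs => rw [A.eq_sum_wigner_smul_phasePoint X]
  simp only [map_sum, map_smul, wigner_sum, wigner_smul]

/-- The reference coordinate is a spectator: only the kernel of `N` enters, acting on the `A`
coordinate. -/
theorem wigner_idTensor (R A B : QSystem) (N : OpMap A.Basis B.Basis) (ρ : (R.tensor A).Op)
    (r : R.Phase) (v : B.Phase) :
    (R.tensor B).wigner (idTensor R.Basis N ρ) (r, v) =
      ∑ u, (R.tensor A).wigner ρ (r, u) * B.wigner (N (A.phasePoint u)) v := by
  rw [wigner_tensor, partialContract_idTensor, wigner_apply_eq_sum, Finset.mul_sum]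
  exact Finset.sum_congr rfl fun u _ => by rw [wigner_tensor, mul_assoc]

theorem wigner_choi (A B : QSystem) (N : OpMap A.Basis B.Basis) (u : A.Phase) (v : B.Phase) :
    (A.tensor B).wigner (choi N) (u, v) =
      1 / (A.dim : ℂ) * B.wigner (N (A.phasePoint u)ᵀ) v := by
  rw [wigner_tensor, partialContract_choi]

theorem _root_.IsChannel.isCPWP {A B : QSystem} {N : OpMap A.Basis B.Basis} (hN : IsChannel N)
    (h : ∀ u v, 0 ≤ B.wigner (N (A.phasePoint u)) v) : IsCPWP A B N := by
  refine ⟨hN.1.isHermiticityPreserving, fun R ρ hρ => ⟨hN.1 _ _ hρ.1, ?_, ?_⟩⟩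
  · exact (trace_idTensor hN.2 ρ).trans hρ.2.1
  · rintro ⟨r, v⟩
    rw [wigner_idTensor]
    exact Finset.sum_nonneg fun u _ => mul_nonneg (hρ.2.2 _) (h u v)

/-- This is the maximally entangled state. Its Wigner values are positive multiples of `Tr[A_v
A_uᵀ]`, and `A_uᵀ` is again a phase-space point operator. -/
theorem choi_id_mem_wignerStates (A : QSystem) :
    ((1 / (A.dim : ℂ)) • choi (LinearMap.id : OpMap A.Basis A.Basis) : (A.tensor A).Op) ∈
      (A.tensor A).wignerStates := by
  refine ⟨?_, ?_, ?_⟩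
  · refine Matrix.PosSemidef.smul ?_ A.one_div_dim_nonneg
    have h : choi (LinearMap.id : OpMap A.Basis A.Basis) =
        Matrix.vecMulVec (fun p => if p.1 = p.2 then 1 else 0)
          (star fun p => if p.1 = p.2 then 1 else 0) := by
      ext p q
      rw [choi_apply, LinearMap.id_apply, Matrix.single_apply, Matrix.vecMulVec_apply,
        Pi.star_apply, apply_ite star, star_one, star_zero]
      by_cases h1 : p.1 = p.2 <;> by_cases h2 : q.1 = q.2 <;> simp [h1, h2]
    rw [h]
    exact Matrix.posSemidef_vecMulVec_self_star _
  · rw [Matrix.trace_smul, Matrix.trace]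
    have h : ∑ p : A.Basis × A.Basis,
        (choi (LinearMap.id : OpMap A.Basis A.Basis)).diag p = A.dim := by
      simp only [Matrix.diag_apply, choi_apply, LinearMap.id_apply, Fintype.sum_prod_type,
        Matrix.single_apply, and_self]
      simp [dim]
    refine (congrArg _ h).trans ?_
    rw [smul_eq_mul, one_div, inv_mul_cancel₀ A.dim_ne_zero]
  · rintro ⟨u, v⟩
    obtain ⟨u', hu⟩ := A.exists_phasePoint_eq_transpose u
    rw [wigner_smul, wigner_choi, LinearMap.id_apply, ← hu]
    exact mul_nonneg A.one_div_dim_nonneg (mul_nonneg A.one_div_dim_nonneg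
      (mul_nonneg A.one_div_dim_nonneg (A.trace_phasePoint_mul_nonneg _ _)))

theorem idTensor_choi_id {a b : Type} [Fintype a] [DecidableEq a] (N : OpMap a b) :
    idTensor a N (choi (LinearMap.id : OpMap a a)) = choi N := by
  ext p q
  rw [choi_apply]
  simp only [idTensor, LinearMap.coe_mk, AddHom.coe_mk, choi_apply, LinearMap.id_apply]
  rfl

/-- Acting on half of the maximally entangled state gives the normalised Choi operator, whose Wigner
function at the transposed point is the kernel entry over `d_A²`. -/
theorem _root_.IsCPWP.wigner_nonneg {A B : QSystem} {N : OpMap A.Basis B.Basis}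
    (hN : IsCPWP A B N) (u : A.Phase) (v : B.Phase) :
    0 ≤ B.wigner (N (A.phasePoint u)) v := by
  obtain ⟨u', hu⟩ := A.exists_phasePoint_eq_transpose u
  have h := (hN.2 A _ A.choi_id_mem_wignerStates).2.2 (u', v)
  rw [map_smul, idTensor_choi_id, wigner_smul, wigner_choi, hu, Matrix.transpose_transpose,
    ← mul_assoc] at h
  have hd := A.dim_ne_zero
  have h2 : B.wigner (N (A.phasePoint u)) v = ((A.dim : ℂ) * A.dim) *
      (1 / (A.dim : ℂ) * (1 / (A.dim : ℂ)) * B.wigner (N (A.phasePoint u)) v) := by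
    field_simp
  rw [h2]
  exact mul_nonneg (by positivity) h

theorem opMap_eq_sum_measPrep (A B : QSystem) (L : OpMap A.Basis B.Basis) :
    L = ∑ u, ∑ v, (B.wigner (L (A.phasePoint u)) v * (1 / (A.dim : ℂ))) •
      measPrep (A.phasePoint u) (B.phasePoint v) := by
  ext1 X
  conv_lhs => rw [A.eq_sum_wigner_smul_phasePoint X, map_sum]
  rw [LinearMap.sum_apply]
  refine Finset.sum_congr rfl fun u _ => ?_
  rw [map_smul, LinearMap.sum_apply]
  conv_lhs => rw [B.eq_sum_wigner_smul_phasePoint (L (A.phasePoint u)), Finset.smul_sum]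
  refine Finset.sum_congr rfl fun v _ => ?_
  rw [LinearMap.smul_apply, measPrep_apply, smul_smul, smul_smul, wigner]
  congr 1
  ring

theorem superWigner_eq {A B C D : QSystem} (Ξ : SuperMap A.Basis B.Basis C.Basis D.Basis)
    (uA : A.Phase) (vD : D.Phase) (uC : C.Phase) (vB : B.Phase) :
    superWigner Ξ uA vD uC vB = 1 / (A.dim : ℂ) *
      D.wigner (Ξ (measPrep (A.phasePoint uA) (B.phasePoint vB)) (C.phasePoint uC)) vD := by
  rw [superWigner, trace_kronecker_mul_bipartiteMap, wigner]
  ring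

/-- Composition law: expand the contracted map in measure-and-prepare maps; `Ξ` turns each of them
into an entry of `W_Ξ`. -/
theorem wigner_idTensorSuper {R A B C D : QSystem}
    (Ξ : SuperMap A.Basis B.Basis C.Basis D.Basis)
    (N : OpMap (R.tensor A).Basis (R.tensor B).Basis)
    (r r' : R.Phase) (uC : C.Phase) (vD : D.Phase) :
    (R.tensor D).wigner (idTensorSuper R.Basis Ξ N ((R.tensor C).phasePoint (r, uC))) (r', vD) =
      ∑ uA, ∑ vB, superWigner Ξ uA vD uC vB *
        (R.tensor B).wigner (N ((R.tensor A).phasePoint (r, uA))) (r', vB) := by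
  have h : ∀ u, contractMap (R.phasePoint r') (R.phasePoint r) N (A.phasePoint u) =
      partialContract (R.phasePoint r') (N ((R.tensor A).phasePoint (r, u))) := fun u => by
    rw [phasePoint_tensor]; rfl
  rw [wigner_tensor, phasePoint_tensor, partialContract_idTensorSuper,
    A.opMap_eq_sum_measPrep B (contractMap _ _ N)]
  simp only [map_sum, map_smul, LinearMap.sum_apply, LinearMap.smul_apply, wigner_sum,
    wigner_smul, Finset.mul_sum]
  refine Finset.sum_congr rfl fun u _ => Finset.sum_congr rfl fun v _ => ?_
  rw [superWigner_eq, wigner_tensor, h]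
  ring

end QSystem

/-- The map `AB ⊗ A → AB ⊗ B` moving the last factor to the first one and the second factor to
the last one, discarding the first factor and preparing the second in the maximally mixed state. -/
def routeMap (a b : Type) [Fintype a] [Fintype b] [DecidableEq b] :
    OpMap ((a × b) × a) ((a × b) × b) where
  toFun X := Matrix.of fun p q => if p.1.2 = q.1.2 then
    (1 / (Fintype.card b : ℂ)) * ∑ x, X ((x, p.2), p.1.1) ((x, q.2), q.1.1) else 0
  map_add' X Y := by
    ext p q
    by_cases h : p.1.2 = q.1.2 <;> simp [h, Finset.sum_add_distrib, mul_add]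
  map_smul' t X := by
    ext p q
    by_cases h : p.1.2 = q.1.2 <;> simp [h, Finset.mul_sum, mul_left_comm]

theorem routeMap_apply (a b : Type) [Fintype a] [Fintype b] [DecidableEq b]
    (X : Matrix ((a × b) × a) ((a × b) × a) ℂ) (p q : (a × b) × b) :
    routeMap a b X p q = if p.1.2 = q.1.2 then
    (1 / (Fintype.card b : ℂ)) * ∑ x, X ((x, p.2), p.1.1) ((x, q.2), q.1.1) else 0 := rfl

theorem routeMap_kronecker {a b : Type} [Fintype a] [Fintype b] [DecidableEq b]
    (V : Matrix a a ℂ) (Y : Matrix b b ℂ) (W : Matrix a a ℂ) :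
    routeMap a b ((V ⊗ₖ Y) ⊗ₖ W) =
      (V.trace * (1 / (Fintype.card b : ℂ))) • ((W ⊗ₖ (1 : Matrix b b ℂ)) ⊗ₖ Y) := by
  ext p q
  rw [routeMap_apply, Matrix.trace]
  by_cases h : p.1.2 = q.1.2
  · have h1 : (1 : Matrix b b ℂ) p.1.2 q.1.2 = 1 := by rw [h, Matrix.one_apply_eq]
    simp only [if_pos h, h1, Matrix.kroneckerMap_apply, Matrix.smul_apply,
      mul_one, ← Finset.sum_mul, Matrix.diag_apply, smul_eq_mul]
    ring
  · simp [h, Matrix.one_apply_ne h]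

theorem isChannel_routeMap (a b : Type) [Fintype a] [Fintype b] [DecidableEq b] [Nonempty b] :
    IsChannel (routeMap a b) := by
  constructor
  · intro r _ _ X hX
    -- For each value `x` of the discarded index, a submatrix of `X` is tensored with the identity
    -- and relabelled, so positivity is manifest.
    have h : idTensor r (routeMap a b) X = (1 / (Fintype.card b : ℂ)) • ∑ x : a,
        ((1 : Matrix b b ℂ) ⊗ₖ X.submatrix
          (fun z : r × a × b => (z.1, ((x, z.2.2), z.2.1)))
          (fun z : r × a × b => (z.1, ((x, z.2.2), z.2.1)))).submatrix
            (fun p : r × ((a × b) × b) => (p.2.1.2, (p.1, (p.2.1.1, p.2.2))))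
            (fun p : r × ((a × b) × b) => (p.2.1.2, (p.1, (p.2.1.1, p.2.2)))) := by
      ext p q
      simp only [idTensor, LinearMap.coe_mk, AddHom.coe_mk, Matrix.of_apply, routeMap_apply,
        Matrix.smul_apply, Matrix.sum_apply, Matrix.submatrix_apply, Matrix.kroneckerMap_apply,
        Matrix.one_apply, smul_eq_mul]
      by_cases h : p.2.1.2 = q.2.1.2 <;> simp [h]
    rw [h]
    refine Matrix.PosSemidef.smul (Matrix.posSemidef_sum _ fun x _ => ?_) (by positivity)
    classical
    exact (Matrix.PosSemidef.one.kronecker (hX.submatrix _)).submatrix _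
  · intro X
    have : (Fintype.card b : ℂ) ≠ 0 := Nat.cast_ne_zero.2 Fintype.card_ne_zero
    simp only [Matrix.trace, Matrix.diag_apply, Fintype.sum_prod_type, routeMap_apply, if_true,
      ← Finset.mul_sum, Finset.sum_const, Finset.card_univ, nsmul_eq_mul]
    rw [mul_left_comm, one_div, mul_inv_cancel_left₀ this,
      Finset.sum_congr rfl fun i _ => Finset.sum_comm, Finset.sum_comm]
    exact Finset.sum_congr rfl fun x _ => Finset.sum_comm

namespace QSystem

/-- One factor `1/d_B` normalises the maximally mixed state, the other is the Wigner function of `1`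
at `b'`. The value depends on neither `a` nor `b'`. -/
theorem wigner_routeMap (A B : QSystem) (a a' u : A.Phase) (b b' v : B.Phase) :
    (((A.tensor B).tensor B).wigner (routeMap A.Basis B.Basis
      (((A.tensor B).tensor A).phasePoint ((a, b), u))) ((a', b'), v)) =
      1 / (B.dim : ℂ) * (1 / (B.dim : ℂ)) * ((if a' = u then 1 else 0) * if v = b then 1 else 0) := by
  rw [phasePoint_tensor, phasePoint_tensor]
  refine (congrArg (fun M => ((A.tensor B).tensor B).wigner M ((a', b'), v))
    (routeMap_kronecker _ _ _)).trans ?_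
  rw [wigner_smul]
  refine (congrArg _ ((wigner_kronecker (A.tensor B) B _ _ _ _).trans
    (congrArg (· * _) (wigner_kronecker A B _ _ _ _)))).trans ?_
  rw [trace_phasePoint, wigner_phasePoint, wigner_phasePoint]
  have h : B.wigner (1 : Matrix B.Basis B.Basis ℂ) b' = 1 / (B.dim : ℂ) := by
    rw [wigner, mul_one, trace_phasePoint, mul_one]
  rw [h, dim]
  ring

end QSystem
end

/-! ### The implications between the four conditions -/

section
open QSystem

variable {A B C D : QSystem} {Ξ : SuperMap A.Basis B.Basis C.Basis D.Basis}

theorem IsSuperchannel.isCPWPSuper (hΞ : IsSuperchannel Ξ)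
    (h : ∀ uA vD uC vB, 0 ≤ superWigner Ξ uA vD uC vB) : IsCPWPSuper Ξ := by
  intro R N hN hW
  refine (hΞ R.Basis N hN).isCPWP (A := R.tensor C) (B := R.tensor D) ?_
  rintro ⟨r, uC⟩ ⟨r', vD⟩
  refine (Finset.sum_nonneg fun uA _ => Finset.sum_nonneg fun vB _ =>
    mul_nonneg (h uA vD uC vB) ?_).trans_eq (wigner_idTensorSuper Ξ N r r' uC vD).symm
  exact hW.wigner_nonneg _ _

theorem IsCPWPSuper.superWigner_nonneg (h : IsCPWPSuper Ξ)
    (uA : A.Phase) (vD : D.Phase) (uC : C.Phase) (vB : B.Phase) :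
    0 ≤ superWigner Ξ uA vD uC vB := by
  have hR := isChannel_routeMap A.Basis B.Basis
  have hN : IsCPWP ((A.tensor B).tensor A) ((A.tensor B).tensor B)
      (routeMap A.Basis B.Basis) := by
    refine hR.isCPWP (A := (A.tensor B).tensor A) (B := (A.tensor B).tensor B) ?_
    rintro ⟨⟨a, b⟩, u⟩ ⟨⟨a', b'⟩, v⟩
    rw [wigner_routeMap]
    refine mul_nonneg (mul_nonneg B.one_div_dim_nonneg B.one_div_dim_nonneg) ?_
    split_ifs <;> simp
  -- The input reference point fixes `b = vB` and the output one fixes `a' = uA`, which selects one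
  -- term of the sum. The other two reference coordinates are arbitrary.
  have hM := (h (A.tensor B) _ hR hN).wigner_nonneg ((uA, vB), uC) ((uA, vB), vD)
  have hsum := wigner_idTensorSuper (R := A.tensor B) Ξ (routeMap A.Basis B.Basis)
    (uA, vB) (uA, vB) uC vD
  have h0 := hM.trans_eq (hsum.trans (Finset.sum_congr rfl fun u _ => Finset.sum_congr rfl fun v _ =>
    congrArg (superWigner Ξ u vD uC v * ·) (wigner_routeMap A B uA uA u vB vB v)))
  rw [Finset.sum_eq_single uA (fun u _ hu => Finset.sum_eq_zero fun v _ => by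
      rw [if_neg hu.symm]; ring) (by simp),
    Finset.sum_eq_single vB (fun v _ hv => by rw [if_neg hv]; ring) (by simp)] at h0
  have hB := B.dim_ne_zero
  have e : superWigner Ξ uA vD uC vB = ((B.dim : ℂ) * B.dim) * (superWigner Ξ uA vD uC vB *
      (1 / (B.dim : ℂ) * (1 / (B.dim : ℂ)) * ((if uA = uA then 1 else 0) *
        if vB = vB then 1 else 0))) := by
    simp only [if_true]
    field_simp
  rw [e]
  exact mul_nonneg (by positivity) h0

theorem wigner_choi_bipartiteMap (Ξ : SuperMap A.Basis B.Basis C.Basis D.Basis)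
    {uC uC' : C.Phase} {vB vB' : B.Phase} (hC : C.phasePoint uC' = (C.phasePoint uC)ᵀ)
    (hB : B.phasePoint vB' = (B.phasePoint vB)ᵀ) (uA : A.Phase) (vD : D.Phase) :
    ((C.tensor B).tensor (A.tensor D)).wigner (choi (bipartiteMap Ξ)) ((uC, vB), (uA, vD)) =
      1 / ((C.tensor B).dim : ℂ) * superWigner Ξ uA vD uC' vB' := by
  refine (wigner_choi (C.tensor B) (A.tensor D) (bipartiteMap Ξ) (uC, vB) (uA, vD)).trans ?_
  have ht : ((C.tensor B).phasePoint (uC, vB))ᵀ = C.phasePoint uC' ⊗ₖ B.phasePoint vB' := by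
    rw [phasePoint_tensor, hC, hB]; rfl
  rw [ht, superWigner, wigner, phasePoint_tensor, dim_tensor A D, Nat.cast_mul]

theorem wigner_choi_bipartiteMap_nonneg_iff :
    (∀ u, 0 ≤ ((C.tensor B).tensor (A.tensor D)).wigner (choi (bipartiteMap Ξ)) u) ↔
      ∀ uA vD uC vB, 0 ≤ superWigner Ξ uA vD uC vB := by
  constructor
  · intro h uA vD uC vB
    obtain ⟨uC', hC⟩ := C.exists_phasePoint_eq_transpose uC
    obtain ⟨vB', hB⟩ := B.exists_phasePoint_eq_transpose vB
    have h0 := h ((uC', vB'), (uA, vD))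
    rw [wigner_choi_bipartiteMap Ξ (uC' := uC) (vB' := vB) (by rw [hC, Matrix.transpose_transpose])
      (by rw [hB, Matrix.transpose_transpose])] at h0
    have e : superWigner Ξ uA vD uC vB = ((C.tensor B).dim : ℂ) *
        (1 / ((C.tensor B).dim : ℂ) * superWigner Ξ uA vD uC vB) := by
      rw [one_div, mul_inv_cancel_left₀ (C.tensor B).dim_ne_zero]
    rw [e]
    exact mul_nonneg (by positivity) h0
  · rintro h ⟨⟨uC, vB⟩, ⟨uA, vD⟩⟩
    obtain ⟨uC', hC⟩ := C.exists_phasePoint_eq_transpose uC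
    obtain ⟨vB', hB⟩ := B.exists_phasePoint_eq_transpose vB
    rw [wigner_choi_bipartiteMap Ξ hC hB]
    exact mul_nonneg (one_div_dim_nonneg _) (h _ _ _ _)

theorem sum_superWigner (Ξ : SuperMap A.Basis B.Basis C.Basis D.Basis) (uA : A.Phase)
    (uC : C.Phase) (vB : B.Phase) :
    ∑ vD, superWigner Ξ uA vD uC vB = 1 / (A.dim : ℂ) *
      (Ξ (measPrep (A.phasePoint uA) (B.phasePoint vB)) (C.phasePoint uC)).trace := by
  simp only [superWigner_eq]
  rw [← Finset.mul_sum, sum_wigner]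

theorem sum_measPrep_phasePoint (A : QSystem) {b : Type} (Y : Matrix b b ℂ) :
    ∑ u, measPrep (A.phasePoint u) Y = (A.dim : ℂ) • measPrep (1 : A.Op) Y := by
  ext1 X
  rw [LinearMap.sum_apply, LinearMap.smul_apply]
  simp only [measPrep_apply]
  rw [← Finset.sum_smul, ← Matrix.trace_sum, ← Finset.sum_mul, sum_phasePoint, Matrix.smul_mul,
    Matrix.trace_smul, smul_assoc]

/-- Summing over `vD` leaves a trace of `Ξ` at a measure-and-prepare map. Summing further over `uA`
gives `d_A` times the trace-preserving map `X ↦ Tr[X] A_{vB}`, hence normalisation. Changing `vB`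
alters the map by a trace-annihilating one because every `A_v` has trace one, hence no signalling.
-/
theorem IsSuperchannel.isNonsignallingChannel (hΞ : IsSuperchannel Ξ)
    (h : ∀ uA vD uC vB, 0 ≤ superWigner Ξ uA vD uC vB) :
    IsNonsignallingChannel (superWigner Ξ) := by
  refine ⟨h, fun uC vB => ?_, fun uA uC vB vB' => ?_⟩
  · simp only [sum_superWigner]
    rw [← Finset.mul_sum, ← Matrix.trace_sum, ← LinearMap.sum_apply, ← map_sum,
      sum_measPrep_phasePoint, map_smul, LinearMap.smul_apply, Matrix.trace_smul,
      hΞ.trace_apply_of_trace, trace_phasePoint, smul_eq_mul, mul_one, one_div,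
      inv_mul_cancel₀ A.dim_ne_zero]
    intro X
    rw [measPrep_apply, Matrix.trace_smul, trace_phasePoint, smul_eq_mul, mul_one, one_mul]
  · rw [sum_superWigner, sum_superWigner]
    congr 1
    rw [← sub_eq_zero, ← Matrix.trace_sub, ← LinearMap.sub_apply, ← map_sub]
    refine hΞ.trace_apply_eq_zero (fun X => ?_) _
    rw [LinearMap.sub_apply, Matrix.trace_sub, measPrep_apply, measPrep_apply, Matrix.trace_smul,
      Matrix.trace_smul, trace_phasePoint, trace_phasePoint, sub_self]

end

theorem mainTheorem2 (A B C D : QSystem) (Ξ : SuperMap A.Basis B.Basis C.Basis D.Basis)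
    (hΞ : IsSuperchannel Ξ) :
    List.TFAE [
      IsCPWPSuper Ξ,
      ∀ u, 0 ≤ ((C.tensor B).tensor (A.tensor D)).wigner (choi (bipartiteMap Ξ)) u,
      ∀ (uA : A.Phase) (vD : D.Phase) (uC : C.Phase) (vB : B.Phase),
        0 ≤ superWigner Ξ uA vD uC vB,
      IsNonsignallingChannel (superWigner Ξ)] := by
  tfae_have 1 → 3 := IsCPWPSuper.superWigner_nonneg
  tfae_have 3 → 1 := hΞ.isCPWPSuper
  tfae_have 2 ↔ 3 := wigner_choi_bipartiteMap_nonneg_iff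
  tfae_have 3 → 4 := hΞ.isNonsignallingChannel
  tfae_have 4 → 3 := fun h => h.1
  tfae_finish
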